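/- Let $\mathcal A$ be a finite alphabet with $D$ letters, and let $P=(p_1,\dots,p_n)$ satisfy $p_i>0$ for all $i$ and $\sum_i p_i=1$. A prefix code for $P$ assigns to the symbols $1,\dots,n$ distinct finite strings over $\mathcal A$ (the empty string is allowed), none of which is a prefix of another; if the $i$-th codeword has length $l_i$, its expected length is $\sum_i p_i l_i$. A prefix code for $P$ of minimum expected length is called optimal. A list $\mathsf L$ is an optimal length sequence for $P$ if it consists of the codeword lengths, in non-decreasing order, of some optimal code for $P$. A Huffman tree for $P$ is any rooted tree that can be produced by the following algorithm. Start with the forest of $n$ isolated vertices, the $i$-th of which has probability $p_i$; if $n=1$, this vertex is the result. If $n\ge 2$, let $m$ be an integer with $2\le m\le D$ such that $D-1$ divides $n-m$ (if $D\le 1$ there is no such $m$, but then there is no prefix code for $P$ either). Choose $m$ roots having the lowest $m$ probabilities and make them the children of a new root, whose probability is the sum of theirs. Then, as long as the forest is not a single tree, choose $D$ roots having the lowest $D$ probabilities and make them the children of a new root, whose probability is the sum of theirs. Ties may be resolved in any way. The length sequence of a tree is the list of the levels (distances from the root) of its leaves in non-decreasing order. Then, for every optimal length sequence $\mathsf L$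 for $P$, there exists a Huffman tree for $P$ whose length sequence is $\mathsf L$. -/

import Mathlib

namespace HuffmanCoding

/-- The set `𝒫ₙ` of probability mass functions `(p₁, …, pₙ)` with all probabilities positive. -/
def posPMF (n : ℕ) : Set (Fin n → ℝ) :=
  {p | (∀ i, 0 < p i) ∧ ∑ i, p i = 1}

/-! ### Prefix codes -/

section Codes

variable {A : Type*} {n : ℕ}

/-- `c` assigns to the `n` source symbols pairwise distinct codewords over the alphabet `A`, and
no codeword is a prefix of another one. (Distinctness follows, a word being a prefix of itself.) -/
def IsPrefixCode (c : Fin n → List A) : Prop :=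
  ∀ i j, i ≠ j → ¬ c i <+: c j

/-- The expected length `∑ᵢ pᵢ lᵢ` of a code. -/
noncomputable def expectedLength (p : Fin n → ℝ) (c : Fin n → List A) : ℝ :=
  ∑ i, p i * ((c i).length : ℝ)

/-- An optimal code for `p`: a prefix code of minimum expected length. -/
def IsOptimalCode (p : Fin n → ℝ) (c : Fin n → List A) : Prop :=
  IsPrefixCode c ∧
    ∀ c' : Fin n → List A, IsPrefixCode c' → expectedLength p c ≤ expectedLength p c'

/-- The length sequence of a code: its codeword lengths in non-decreasing order. -/
def codeLengthSeq (c : Fin n → List A) : List ℕ :=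
  (Multiset.map (fun i => (c i).length) Finset.univ.val).sort (· ≤ ·)

end Codes

/-- `L` is an optimal length sequence for `p` (over the alphabet `A`): it is the length sequence
of an optimal code for `p`. -/
def IsOptimalLengthSeq (A : Type*) {n : ℕ} (p : Fin n → ℝ) (L : List ℕ) : Prop :=
  ∃ c : Fin n → List A, IsOptimalCode p c ∧ codeLengthSeq c = L

/-! ### Trees and the Huffman algorithm -/

/-- Finite rooted trees whose leaves carry source symbols from `Fin n`. The children of an internal
node are listed in some order; every order is allowed in the algorithm below. -/
inductive CodeTree (n : ℕ) : Type
  | leaf (i : Fin n) : CodeTree n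
  | node (k : ℕ) (children : Fin k → CodeTree n) : CodeTree n

namespace CodeTree

variable {n : ℕ}

/-- The probability of the root: a leaf has the probability of its symbol, an internal node has the
sum of the probabilities of its children. -/
noncomputable def prob (p : Fin n → ℝ) : CodeTree n → ℝ
  | leaf i => p i
  | node _ children => ∑ j, (children j).prob p

/-- The levels of the leaves (lengths of the paths from the root), with multiplicity. -/
def leafLevels : CodeTree n → Multiset ℕ
  | leaf _ => {0}
  | node _ children => ∑ j, (children j).leafLevels.map (· + 1)

/-- The length sequence of a tree: the levels of its leaves, that is, the codeword lengths of the
prefix codes which it represents, in non-decreasing order. -/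
def lengthSeq (T : CodeTree n) : List ℕ :=
  T.leafLevels.sort (· ≤ ·)

end CodeTree

/-- The forest `F₁` of `n` isolated vertices, one for each source symbol. -/
def initialForest (n : ℕ) : Multiset (CodeTree n) :=
  Multiset.map CodeTree.leaf Finset.univ.val

/-- One merging step: `k` trees of the forest `F` whose roots have the lowest `k` probabilities are
chosen (in any way, if there are ties) and become the children of a new root, which gives `F'`.
`R` is the collection of the trees that are not chosen. -/
def Merge {n : ℕ} (p : Fin n → ℝ) (k : ℕ) (F F' : Multiset (CodeTree n)) : Prop :=
  ∃ (children : Fin k → CodeTree n) (R : Multiset (CodeTree n)),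
    F = Multiset.map children Finset.univ.val + R ∧
    (∀ j, ∀ t ∈ R, (children j).prob p ≤ t.prob p) ∧
    F' = CodeTree.node k children ::ₘ R

/-- `T` is a Huffman tree for `p` with respect to an alphabet of `D` letters: it is a possible
result of the Huffman algorithm. If `F₁` is a single tree (`n = 1`), this tree is the result.
Otherwise the first step merges `m` trees, where `2 ≤ m ≤ D` and `D - 1` divides `n - m`, and every
later step merges `D` trees, until the forest is a single tree. -/
def IsHuffmanTree (D : ℕ) {n : ℕ} (p : Fin n → ℝ) (T : CodeTree n) : Prop :=
  initialForest n = {T} ∨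
    ∃ (m : ℕ) (F : Multiset (CodeTree n)),
      2 ≤ m ∧ m ≤ D ∧ ((D : ℤ) - 1) ∣ ((n : ℤ) - (m : ℤ)) ∧
      Merge p m (initialForest n) F ∧
      Relation.ReflTransGen (Merge p D) F {T}

end HuffmanCoding

/-! The Huffman algorithm is steered by the given optimal code. Each root of the forest carries a
level, initially the codeword length, and the invariant is that these levels minimise the weighted
cost subject to Kraft's inequality.

Let `L + 1` be the greatest level. Multiplied by `D ^ (L + 1)`, the Kraft sum is an integer. Its
slack below `D ^ (L + 1)` is less than `D - 1`, since otherwise a longest word could be shortened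
(`slack_lt`). Modulo `D - 1` the integer counts all roots, so the slack is exactly `D - m`. Modulo
`D` it counts the deepest roots, so there are at least `m` of them. By exchange (`weight_le`) deeper
roots weigh no more, so `m` lightest deepest roots are lightest overall, a legal Huffman choice
(`exists_split`).

Their parent fits at level `L`. Any better assignment after the merge would expand to a better one
before it, so optimality persists (`merge`). Leaf levels never change (`forestLevels_merge`), and
the last root has level 0. -/

namespace HuffmanCoding

/-! ### Weighted length assignments -/

section Assignments

variable {α : Type*}

/-- The Kraft sum of a multiset of objects with assigned lengths. -/
noncomputable def kraftSum (D : ℕ) (s : Multiset (α × ℕ)) : ℝ :=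
  (s.map fun x => (1 / (D : ℝ)) ^ x.2).sum

/-- The total weighted length of a multiset of objects with assigned lengths. -/
noncomputable def cost (w : α → ℝ) (s : Multiset (α × ℕ)) : ℝ :=
  (s.map fun x => w x.1 * (x.2 : ℝ)).sum

/-- `s` has minimum cost among all assignments of lengths to the same objects that satisfy
Kraft's inequality. -/
def IsOptimalAssignment (D : ℕ) (w : α → ℝ) (s : Multiset (α × ℕ)) : Prop :=
  kraftSum D s ≤ 1 ∧
    ∀ u : Multiset (α × ℕ), u.map Prod.fst = s.map Prod.fst → kraftSum D u ≤ 1 →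
      cost w s ≤ cost w u

@[simp] lemma kraftSum_cons (D : ℕ) (x : α × ℕ) (s : Multiset (α × ℕ)) :
    kraftSum D (x ::ₘ s) = (1 / (D : ℝ)) ^ x.2 + kraftSum D s := by
  simp [kraftSum]

@[simp] lemma kraftSum_add (D : ℕ) (s t : Multiset (α × ℕ)) :
    kraftSum D (s + t) = kraftSum D s + kraftSum D t := by
  simp [kraftSum]

@[simp] lemma cost_cons (w : α → ℝ) (x : α × ℕ) (s : Multiset (α × ℕ)) :
    cost w (x ::ₘ s) = w x.1 * x.2 + cost w s := by
  simp [cost]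

@[simp] lemma cost_add (w : α → ℝ) (s t : Multiset (α × ℕ)) :
    cost w (s + t) = cost w s + cost w t := by
  simp [cost]

lemma kraftSum_eq_of_forall_eq {D : ℕ} {s : Multiset (α × ℕ)} {L : ℕ} (h : ∀ x ∈ s, x.2 = L) :
    kraftSum D s = s.card * (1 / (D : ℝ)) ^ L := by
  rw [kraftSum, Multiset.map_congr rfl fun x hx => by rw [h x hx]]
  simp

lemma cost_eq_of_forall_eq {w : α → ℝ} {s : Multiset (α × ℕ)} {L : ℕ} (h : ∀ x ∈ s, x.2 = L) :
    cost w s = (s.map fun x => w x.1).sum * L := by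
  rw [cost, Multiset.map_congr rfl fun x hx => by rw [h x hx], Multiset.sum_map_mul_right]

/-- Clearing denominators makes the Kraft sum an integer, open to congruences. -/
lemma pow_mul_kraftSum {D : ℕ} (hD : 0 < D) {s : Multiset (α × ℕ)} {L : ℕ}
    (h : ∀ x ∈ s, x.2 ≤ L) :
    (D : ℝ) ^ L * kraftSum D s = (((s.map fun x => (D : ℤ) ^ (L - x.2)).sum : ℤ) : ℝ) := by
  induction s using Multiset.induction with
  | empty => simp [kraftSum]
  | cons a s ih =>
    have hD' : (D : ℝ) ≠ 0 := by positivity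
    have ha : a.2 ≤ L := h a (by simp)
    rw [kraftSum_cons, mul_add, ih fun x hx => h x (by simp [hx]), Multiset.map_cons,
      Multiset.sum_cons]
    push_cast
    rw [one_div, inv_pow, pow_sub₀ _ hD' ha]

/-- Every power of `D` is 1 modulo `D - 1`. -/
lemma sub_one_dvd_sum_pow_sub_card (D : ℤ) (e : α → ℕ) (s : Multiset α) :
    D - 1 ∣ (s.map fun x => D ^ e x).sum - s.card := by
  induction s using Multiset.induction with
  | empty => simp
  | cons a s ih =>
    have h := dvd_add (sub_one_dvd_pow_sub_one D (e a)) ih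
    simp only [Multiset.map_cons, Multiset.sum_cons, Multiset.card_cons]
    push_cast
    convert! h using 1
    ring

/-- Modulo `D` only the terms with exponent 0 survive, those of length `L`. -/
lemma dvd_sum_pow_sub_card_filter (D : ℤ) (s : Multiset (α × ℕ)) {L : ℕ} (h : ∀ x ∈ s, x.2 ≤ L) :
    D ∣ (s.map fun x => D ^ (L - x.2)).sum - (s.filter fun x => x.2 = L).card := by
  induction s using Multiset.induction with
  | empty => simp
  | cons a s ih =>
    have ih := ih fun x hx => h x (by simp [hx])
    have ha : a.2 ≤ L := h a (by simp)
    by_cases hL : a.2 = L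
    · rw [Multiset.filter_cons_of_pos (p := fun x : α × ℕ => x.2 = L) s hL]
      simpa [hL, add_sub_add_left_eq_sub, add_comm _ (1 : ℤ)] using ih
    · rw [Multiset.filter_cons_of_neg (p := fun x : α × ℕ => x.2 = L) s hL,
        Multiset.map_cons, Multiset.sum_cons, add_sub_assoc]
      exact dvd_add (dvd_pow_self D (by omega)) ih

/-- Any multiset with at least `k` elements contains `k` elements of lowest weight. -/
lemma exists_lowest (f : α → ℝ) (s : Multiset α) (k : ℕ) (hk : k ≤ s.card) :
    ∃ C R : Multiset α, s = C + R ∧ C.card = k ∧ ∀ x ∈ C, ∀ y ∈ R, f x ≤ f y := by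
  classical
  induction k generalizing s with
  | zero => exact ⟨0, s, by simp⟩
  | succ k ih =>
    have hs : s.toFinset.Nonempty := by
      rw [Multiset.toFinset_nonempty]
      rintro rfl
      simp at hk
    obtain ⟨a, ha, hmin⟩ := s.toFinset.exists_min_image f hs
    obtain ⟨t, rfl⟩ := Multiset.exists_cons_of_mem (Multiset.mem_toFinset.1 ha)
    obtain ⟨C, R, rfl, hC, hCR⟩ := ih t (by simpa using hk)
    refine ⟨a ::ₘ C, R, by simp, by simp [hC], fun x hx y hy => ?_⟩
    rcases Multiset.mem_cons.1 hx with rfl | hx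
    · exact hmin y (by simp [hy])
    · exact hCR x hx y hy

namespace IsOptimalAssignment

variable {D : ℕ} {w : α → ℝ} {s : Multiset (α × ℕ)}

/-- In an optimal assignment, longer lengths belong to objects of lower weight. -/
lemma weight_le (h : IsOptimalAssignment D w s) {x y : α × ℕ} (hx : x ∈ s) (hy : y ∈ s)
    (hxy : y.2 < x.2) : w x.1 ≤ w y.1 := by
  obtain ⟨t, rfl⟩ := Multiset.exists_cons_of_mem hx
  have hyt : y ∈ t := by
    rcases Multiset.mem_cons.1 hy with rfl | h
    · exact absurd hxy (lt_irrefl _)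
    · exact h
  obtain ⟨t, rfl⟩ := Multiset.exists_cons_of_mem hyt
  have hk := h.1
  -- Swapping the two lengths preserves the Kraft sum.
  have := h.2 ((x.1, y.2) ::ₘ (y.1, x.2) ::ₘ t) (by simp) (by
    simp only [kraftSum_cons] at hk ⊢
    linarith)
  simp only [cost_cons] at this
  have hlt : (y.2 : ℝ) < x.2 := by exact_mod_cast hxy
  nlinarith

/-- In an optimal assignment, the slack in Kraft's inequality does not allow shortening a
longest codeword. -/
lemma slack_lt (h : IsOptimalAssignment D w s) (hD : 2 ≤ D) {x : α × ℕ} (hx : x ∈ s)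
    (hw : 0 < w x.1) (hpos : 0 < x.2) (hmax : ∀ y ∈ s, y.2 ≤ x.2) :
    (D : ℤ) ^ x.2 - (s.map fun y => (D : ℤ) ^ (x.2 - y.2)).sum < (D : ℤ) - 1 := by
  by_contra! hcon
  have hDr : (0 : ℝ) < D := by positivity
  have hK := pow_mul_kraftSum (by omega : 0 < D) hmax
  obtain ⟨t, rfl⟩ := Multiset.exists_cons_of_mem hx
  have hp : ((1 : ℝ) / D) ^ (x.2 - 1) = D * (1 / D) ^ x.2 := by
    obtain ⟨k, hk⟩ := Nat.exists_eq_add_of_lt hpos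
    rw [hk]
    simp only [zero_add, Nat.add_sub_cancel, pow_succ]
    field_simp
  -- Shortening `x` by one raises the scaled Kraft sum by exactly `D - 1`, which the slack would
  -- absorb.
  have hle := h.2 ((x.1, x.2 - 1) ::ₘ t) (by simp) (by
    have hcon' : ((D : ℝ)) - 1 ≤ (D : ℝ) ^ x.2 - D ^ x.2 * kraftSum D (x ::ₘ t) := by
      rw [hK]; exact_mod_cast hcon
    have hmul : (D : ℝ) ^ x.2 * (1 / D) ^ x.2 = 1 := by
      rw [← mul_pow, mul_one_div_cancel hDr.ne', one_pow]
    have hpw : (0 : ℝ) < (D : ℝ) ^ x.2 := by positivity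
    refine le_of_mul_le_mul_left ?_ hpw
    simp only [kraftSum_cons] at hcon' ⊢
    rw [hp]
    linear_combination hcon' + ((D : ℝ) - 1) * hmul)
  simp only [cost_cons] at hle
  have : ((x.2 - 1 : ℕ) : ℝ) = x.2 - 1 := by rw [Nat.cast_sub hpos]; simp
  rw [this] at hle
  linarith

/-- The single object of an optimal assignment has length zero. -/
lemma length_eq_zero {x : α × ℕ} (h : IsOptimalAssignment D w {x}) (hw : 0 < w x.1) :
    x.2 = 0 := by
  have := h.2 {(x.1, 0)} (by simp) (by simp [kraftSum])
  simp only [cost, Multiset.map_singleton, Multiset.sum_singleton, Nat.cast_zero, mul_zero] at this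
  by_contra h0
  have : 0 < w x.1 * (x.2 : ℝ) := mul_pos hw (by exact_mod_cast Nat.pos_of_ne_zero h0)
  linarith

/-- An optimal assignment can be split into `m` objects of lowest weight, which have the common
length `L + 1`, and the rest; and there is room for replacing these objects by one of length `L`. -/
lemma exists_split (h : IsOptimalAssignment D w s) (hD : 2 ≤ D) (hw : ∀ x ∈ s, 0 < w x.1)
    (hs : 2 ≤ s.card) {m : ℕ} (hm : 2 ≤ m) (hmD : m ≤ D)
    (hdvd : (D : ℤ) - 1 ∣ (s.card : ℤ) - m) :
    ∃ (C R : Multiset (α × ℕ)) (L : ℕ), s = C + R ∧ C.card = m ∧ (∀ x ∈ C, x.2 = L + 1) ∧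
      (∀ x ∈ C, ∀ y ∈ R, w x.1 ≤ w y.1) ∧ (1 / (D : ℝ)) ^ L + kraftSum D R ≤ 1 := by
  classical
  have hne : s.toFinset.Nonempty := by
    rw [Multiset.toFinset_nonempty]
    rintro rfl
    simp at hs
  obtain ⟨a, ha, hmax⟩ := s.toFinset.exists_max_image Prod.snd hne
  rw [Multiset.mem_toFinset] at ha
  replace hmax : ∀ y ∈ s, y.2 ≤ a.2 := fun y hy => hmax y (by simpa using hy)
  have hDr : (0 : ℝ) < D := by positivity
  have hpos : 0 < a.2 := by
    by_contra h0
    have hk := h.1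
    rw [kraftSum_eq_of_forall_eq (L := 0) fun x hx => by have := hmax x hx; omega] at hk
    have : (2 : ℝ) ≤ s.card := by exact_mod_cast hs
    norm_num at hk
    linarith
  obtain ⟨L, hL⟩ : ∃ L, a.2 = L + 1 := ⟨a.2 - 1, by omega⟩
  have hslack := h.slack_lt hD ha (hw a ha) hpos hmax
  rw [hL] at hslack hmax
  have hK := pow_mul_kraftSum (by omega : 0 < D) hmax
  have h1 := sub_one_dvd_sum_pow_sub_card (D : ℤ) (fun x : α × ℕ => L + 1 - x.2) s
  have h2 := dvd_sum_pow_sub_card_filter (D : ℤ) s hmax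
  have h3 := sub_one_dvd_pow_sub_one (D : ℤ) (L + 1)
  have hKle : (s.map fun y => (D : ℤ) ^ (L + 1 - y.2)).sum ≤ (D : ℤ) ^ (L + 1) := by
    have : (D : ℝ) ^ (L + 1) * kraftSum D s ≤ (D : ℝ) ^ (L + 1) :=
      mul_le_of_le_one_right (by positivity) h.1
    rw [hK] at this
    exact_mod_cast this
  set K := (s.map fun y => (D : ℤ) ^ (L + 1 - y.2)).sum with hKdef
  -- Both sides lie in `[0, D - 1)` and agree modulo `D - 1`.
  have hKeq : (D : ℤ) ^ (L + 1) - K = D - m := by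
    obtain ⟨k, hk⟩ : (D : ℤ) - 1 ∣ ((D : ℤ) ^ (L + 1) - K) - (D - m) := by
      have := dvd_sub (dvd_sub (dvd_sub h3 h1) hdvd) (dvd_refl ((D : ℤ) - 1))
      convert! this using 1
      ring
    have hk0 : k = 0 := by
      rcases lt_trichotomy k 0 with hneg | h0 | hp
      · nlinarith
      · exact h0
      · nlinarith
    rw [hk0] at hk
    linarith
  -- The number of longest words is positive and congruent to `m ≤ D` modulo `D`.
  have hcard : m ≤ (s.filter fun x => x.2 = L + 1).card := by
    have hr : 0 < (s.filter fun x => x.2 = L + 1).card :=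
      Multiset.card_pos_iff_exists_mem.2 ⟨a, Multiset.mem_filter.2 ⟨ha, hL⟩⟩
    obtain ⟨k, hk⟩ : (D : ℤ) ∣ ((s.filter fun x => x.2 = L + 1).card : ℤ) - m := by
      have := dvd_sub (dvd_sub (dvd_pow_self (D : ℤ) (by omega : L + 1 ≠ 0)) h2)
        (dvd_refl (D : ℤ))
      convert! this using 1
      linarith
    have : 0 ≤ k := by
      by_contra! hneg
      have : (D : ℤ) * k ≤ D * (-1) := mul_le_mul_of_nonneg_left (by omega) (by omega)
      omega
    have : (0 : ℤ) ≤ D * k := by positivity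
    omega
  obtain ⟨C, R, hCR, hC, hlow⟩ := exists_lowest (fun x : α × ℕ => w x.1) _ m hcard
  have hCs : ∀ x ∈ C, x ∈ s ∧ x.2 = L + 1 := fun x hx =>
    Multiset.mem_filter.1 (hCR ▸ Multiset.mem_add.2 (Or.inl hx))
  have hsplit : s = C + (R + s.filter fun x => ¬ x.2 = L + 1) := by
    rw [← add_assoc, ← hCR, Multiset.filter_add_not]
  refine ⟨C, _, L, hsplit, hC, fun x hx => (hCs x hx).2, fun x hx y hy => ?_, ?_⟩
  · rcases Multiset.mem_add.1 hy with hy | hy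
    · exact hlow x hx y hy
    · rw [Multiset.mem_filter] at hy
      have := hmax y hy.1
      exact h.weight_le (hCs x hx).1 hy.1 (by rw [(hCs x hx).2]; omega)
  · have hKs : kraftSum D s = kraftSum D C + kraftSum D (R + s.filter fun x => ¬ x.2 = L + 1) := by
      conv_lhs => rw [hsplit]
      rw [kraftSum_add]
    rw [kraftSum_eq_of_forall_eq fun x hx => (hCs x hx).2, hC] at hKs
    have hKr : (D : ℝ) ^ (L + 1) - D ^ (L + 1) * kraftSum D s = D - m := by
      rw [hK]; exact_mod_cast hKeq
    have hmul : (D : ℝ) ^ (L + 1) * (1 / D) ^ (L + 1) = 1 := by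
      rw [← mul_pow, mul_one_div_cancel hDr.ne', one_pow]
    have hp : (D : ℝ) ^ (L + 1) * (1 / D) ^ L = D := by
      rw [pow_succ, mul_right_comm, ← mul_pow, mul_one_div_cancel hDr.ne', one_pow, one_mul]
    have hpw : (0 : ℝ) < (D : ℝ) ^ (L + 1) := by positivity
    -- In units of `D ^ -(L + 1)`, the `m` removed words and the slack `D - m` make `D`, the share
    -- of one word of length `L`.
    refine le_of_mul_le_mul_left ?_ hpw
    rw [hKs] at hKr
    linear_combination hp - hKr - m * hmul

/-- Replacing objects of common length `L + 1` by a single object of length `L` and of their total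
weight keeps an assignment optimal. -/
lemma merge {C R : Multiset (α × ℕ)} (h : IsOptimalAssignment D w (C + R)) (hD : 0 < D)
    (hC : C.card ≤ D) {L : ℕ} (hL : ∀ x ∈ C, x.2 = L + 1)
    (hk : (1 / (D : ℝ)) ^ L + kraftSum D R ≤ 1) {b : α}
    (hb : w b = (C.map fun x => w x.1).sum) :
    IsOptimalAssignment D w ((b, L) ::ₘ R) := by
  classical
  refine ⟨by simpa using hk, fun u hu hku => ?_⟩
  rw [Multiset.map_cons] at hu
  obtain ⟨x, hx, hxb, hxu⟩ := (Multiset.map_eq_cons _ _ _ _).2 hu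
  obtain ⟨t, rfl⟩ := Multiset.exists_cons_of_mem hx
  rw [Multiset.erase_cons_head] at hxu
  obtain ⟨y, l⟩ := x
  simp only at hxb
  subst hxb
  have hCl : ∀ z ∈ C.map fun x => (x.1, l + 1), z.2 = l + 1 := by
    intro z hz
    obtain ⟨x, -, rfl⟩ := Multiset.mem_map.1 hz
    rfl
  have hDr : (0 : ℝ) < D := by positivity
  -- Undo the merge in the competitor: the objects of `C` go one level below `b`. At most `D`
  -- children fit there, and the cost grows by `w b`, just as it does for the original.
  have := h.2 ((C.map fun x => (x.1, l + 1)) + t) (by simp [hxu]) (by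
    rw [kraftSum_add, kraftSum_eq_of_forall_eq hCl, Multiset.card_map]
    rw [kraftSum_cons] at hku
    refine le_trans ?_ hku
    gcongr
    rw [pow_succ, mul_left_comm]
    refine mul_le_of_le_one_right (by positivity) ?_
    rw [mul_one_div, div_le_one hDr]
    exact_mod_cast hC)
  rw [cost_add, cost_add, cost_eq_of_forall_eq hL, cost_eq_of_forall_eq hCl, Multiset.map_map]
    at this
  simp only [Function.comp_def, ← hb] at this
  simp only [cost_cons]
  push_cast at this
  linarith

end IsOptimalAssignment

end Assignments

/-! ### Running the Huffman algorithm -/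

section Algorithm

variable {n : ℕ}

/-- The levels of the leaves of a forest whose roots are placed at the assigned levels. -/
def forestLevels (s : Multiset (CodeTree n × ℕ)) : Multiset ℕ :=
  (s.map fun x => x.1.leafLevels.map (· + x.2)).sum

lemma exists_fin_map_eq {α : Type*} (s : Multiset α) {k : ℕ} (hk : s.card = k) :
    ∃ f : Fin k → α, Multiset.map f Finset.univ.val = s := by
  subst hk
  obtain ⟨l, rfl⟩ := Quot.exists_rep s
  refine ⟨l.get, ?_⟩
  change Multiset.map l.get (Finset.univ : Finset (Fin l.length)).val = _
  rw [Fin.univ_val_map, List.ofFn_get]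
  rfl

/-- The new root is one level higher, and its leaves are one edge deeper in its tree. -/
lemma forestLevels_merge {C R : Multiset (CodeTree n × ℕ)} {L k : ℕ} (hL : ∀ x ∈ C, x.2 = L + 1)
    {f : Fin k → CodeTree n} (hf : Multiset.map f Finset.univ.val = C.map Prod.fst) :
    forestLevels ((CodeTree.node k f, L) ::ₘ R) = forestLevels (C + R) := by
  have hC : C.map (fun x => x.1.leafLevels.map (· + x.2)) =
      (Multiset.map f Finset.univ.val).map fun t => t.leafLevels.map (· + (L + 1)) := by
    rw [hf, Multiset.map_map]
    exact Multiset.map_congr rfl fun x hx => by simp [hL x hx]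
  simp only [forestLevels, Multiset.map_cons, Multiset.sum_cons, Multiset.map_add,
    Multiset.sum_add, hC, Multiset.map_map]
  congr 1
  change Multiset.map _ (∑ j, _) = ∑ j, _
  rw [← Multiset.coe_mapAddMonoidHom, map_sum]
  refine Finset.sum_congr rfl fun j _ => ?_
  simp [Multiset.map_map, add_assoc, add_comm 1 L]

/-- A merging step that respects an optimal assignment of levels to the roots of a forest. -/
lemma exists_merge {D : ℕ} {p : Fin n → ℝ} {s : Multiset (CodeTree n × ℕ)}
    (h : IsOptimalAssignment D (CodeTree.prob p) s) (hD : 2 ≤ D) (hw : ∀ x ∈ s, 0 < x.1.prob p)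
    (hs : 2 ≤ s.card) {m : ℕ} (hm : 2 ≤ m) (hmD : m ≤ D)
    (hdvd : (D : ℤ) - 1 ∣ (s.card : ℤ) - m) :
    ∃ s' : Multiset (CodeTree n × ℕ), Merge p m (s.map Prod.fst) (s'.map Prod.fst) ∧
      IsOptimalAssignment D (CodeTree.prob p) s' ∧ (∀ x ∈ s', 0 < x.1.prob p) ∧
      s'.card + m = s.card + 1 ∧ forestLevels s' = forestLevels s := by
  obtain ⟨C, R, L, rfl, hC, hL, hlow, hk⟩ := h.exists_split hD hw hs hm hmD hdvd
  obtain ⟨f, hf⟩ := exists_fin_map_eq (C.map Prod.fst) (k := m) (by simpa using hC)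
  have hb : (CodeTree.node m f).prob p = (C.map fun x => x.1.prob p).sum := by
    have : C.map (fun x => x.1.prob p) = (C.map Prod.fst).map (CodeTree.prob p) := by
      simp [Multiset.map_map]
    rw [this, ← hf, Multiset.map_map]
    rfl
  have hfC : ∀ j, ∃ x ∈ C, x.1 = f j := fun j =>
    Multiset.mem_map.1 (hf ▸ Multiset.mem_map_of_mem f (Finset.mem_univ j))
  refine ⟨(CodeTree.node m f, L) ::ₘ R, ⟨f, R.map Prod.fst, ?_, ?_, by simp⟩,
    h.merge (by omega) (by omega) hL hk hb, ?_, ?_, forestLevels_merge hL hf⟩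
  · rw [hf, Multiset.map_add]
  · intro j t ht
    obtain ⟨x, hx, hxj⟩ := hfC j
    obtain ⟨y, hy, rfl⟩ := Multiset.mem_map.1 ht
    exact hxj ▸ hlow x hx y hy
  · intro x hx
    rcases Multiset.mem_cons.1 hx with rfl | hx
    · change 0 < ∑ j, (f j).prob p
      refine Finset.sum_pos (fun j _ => ?_) ⟨⟨0, by omega⟩, Finset.mem_univ _⟩
      obtain ⟨x, hx, hxj⟩ := hfC j
      exact hxj ▸ hw x (by simp [hx])
    · exact hw x (by simp [hx])
  · simp only [Multiset.card_cons, Multiset.card_add, hC]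
    omega

/-- Each merge removes `D - 1` trees, so the congruence with 1 persists down to a single tree, whose
level is 0 by optimality. -/
lemma exists_reflTransGen_merge {D : ℕ} (hD : 2 ≤ D) {p : Fin n → ℝ} (N : ℕ)
    {s : Multiset (CodeTree n × ℕ)} (hN : s.card = N)
    (h : IsOptimalAssignment D (CodeTree.prob p) s) (hw : ∀ x ∈ s, 0 < x.1.prob p)
    (hs : 1 ≤ s.card) (hdvd : (D : ℤ) - 1 ∣ (s.card : ℤ) - 1) :
    ∃ T : CodeTree n, Relation.ReflTransGen (Merge p D) (s.map Prod.fst) {T} ∧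
      T.leafLevels = forestLevels s := by
  induction N using Nat.strong_induction_on generalizing s with
  | _ N ih =>
    rcases hs.eq_or_lt with h1 | h2
    · obtain ⟨x, rfl⟩ := Multiset.card_eq_one.1 h1.symm
      have hx := h.length_eq_zero (hw x (by simp))
      exact ⟨x.1, by simpa using Relation.ReflTransGen.refl, by simp [forestLevels, hx]⟩
    · have hd : (D : ℤ) - 1 ∣ (s.card : ℤ) - D := by
        have := dvd_sub hdvd (dvd_refl ((D : ℤ) - 1))
        convert! this using 1
        ring
      obtain ⟨s', hstep, hopt, hw', hcard, hlev⟩ := exists_merge h hD hw h2 hD le_rfl hd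
      have hs' : 1 ≤ s'.card := by
        obtain ⟨f, R, -, -, hR⟩ := hstep
        rw [← Multiset.card_map Prod.fst s', hR]
        simp
      obtain ⟨T, hT, hl⟩ := ih s'.card (by omega) rfl hopt hw' hs' (by
        convert hd using 1
        omega)
      exact ⟨T, hT.head hstep, hl.trans hlev⟩

end Algorithm

/-! ### Kraft's inequality and its converse -/

section Kraft

variable {A : Type*} {n : ℕ}

lemma IsPrefixCode.injective {c : Fin n → List A} (hc : IsPrefixCode c) :
    Function.Injective c := by
  intro i j hij
  by_contra hne
  exact hc i j hne (hij ▸ List.prefix_rfl)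

lemma IsPrefixCode.ne_nil {c : Fin n → List A} (hc : IsPrefixCode c) (hn : 2 ≤ n) (i : Fin n) :
    c i ≠ [] := by
  intro hi
  have : Nontrivial (Fin n) := Fin.nontrivial_iff_two_le.2 hn
  obtain ⟨j, hj⟩ := exists_ne i
  exact hc i j hj.symm (hi ▸ List.nil_prefix)

/-- The first codewords of two equal concatenations are prefixes of one word, hence comparable. With
`n ≥ 2` no codeword is empty. -/
lemma IsPrefixCode.uniquelyDecodable {c : Fin n → List A} (hc : IsPrefixCode c) (hn : 2 ≤ n) :
    InformationTheory.UniquelyDecodable (Set.range c) := by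
  intro L₁
  induction L₁ with
  | nil =>
    intro L₂ _ h₂ h
    cases L₂ with
    | nil => rfl
    | cons b L₂ =>
      obtain ⟨i, rfl⟩ := h₂ b (by simp)
      simp [hc.ne_nil hn i] at h
  | cons a L₁ ih =>
    intro L₂ h₁ h₂ h
    obtain ⟨i, rfl⟩ := h₁ a (by simp)
    cases L₂ with
    | nil => simp [hc.ne_nil hn i] at h
    | cons b L₂ =>
      obtain ⟨j, rfl⟩ := h₂ b (by simp)
      have hij : i = j := by
        by_contra hne
        rw [List.flatten_cons, List.flatten_cons] at h
        rcases List.prefix_or_prefix_of_prefix (List.prefix_append (c i) L₁.flatten)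
          (h ▸ List.prefix_append (c j) L₂.flatten) with hp | hp
        · exact hc i j hne hp
        · exact hc j i (Ne.symm hne) hp
      subst hij
      rw [ih L₂ (fun w hw => h₁ w (by simp [hw])) (fun w hw => h₂ w (by simp [hw]))
        (by simpa using h)]

/-- **Kraft's inequality** for prefix codes. -/
lemma IsPrefixCode.kraft [Fintype A] [Nonempty A] {c : Fin n → List A} (hc : IsPrefixCode c)
    (hn : 2 ≤ n) : ∑ i, (1 / (Fintype.card A : ℝ)) ^ (c i).length ≤ 1 := by
  classical
  have h := InformationTheory.kraft_mcmillan_inequality (S := Finset.univ.image c)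
    (by simpa using hc.uniquelyDecodable hn)
  rwa [Finset.sum_image fun i _ j _ hij => hc.injective hij] at h

/-- The number of words of length `l` that extend a given word. -/
lemma card_filter_prefix_le [Fintype A] [DecidableEq A] (v : List A) (l : ℕ) :
    (Finset.univ.filter fun x : List.Vector A l => v <+: x.1).card ≤
      Fintype.card A ^ (l - v.length) := by
  rw [← card_vector]
  refine Finset.card_le_card_of_injOn
    (fun x => (⟨x.1.drop v.length, by simp [x.2]⟩ : List.Vector A (l - v.length)))
    (fun _ _ => Finset.mem_coe.2 (Finset.mem_univ _)) ?_
  intro x hx y hy hxy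
  simp only [Finset.coe_filter, Finset.mem_univ, true_and, Set.mem_ofPred_eq] at hx hy
  obtain ⟨a, ha⟩ := hx
  obtain ⟨b, hb⟩ := hy
  have : x.1.drop v.length = y.1.drop v.length := congrArg Subtype.val hxy
  apply Subtype.ext
  rw [← ha, ← hb] at this ⊢
  simpa using this

/-- **Converse of Kraft's inequality**: lengths that satisfy it are those of a prefix code. -/
lemma exists_isPrefixCode [Fintype A] [Nonempty A] (l : Fin n → ℕ)
    (hl : ∑ i, (1 / (Fintype.card A : ℝ)) ^ l i ≤ 1) :
    ∃ c : Fin n → List A, IsPrefixCode c ∧ ∀ i, (c i).length = l i := by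
  classical
  have hD : (0 : ℝ) < Fintype.card A := by exact_mod_cast Fintype.card_pos
  suffices H : ∀ S : Finset (Fin n), ∃ c : Fin n → List A, (∀ i, (c i).length = l i) ∧
      ∀ i ∈ S, ∀ j ∈ S, i ≠ j → ¬ c i <+: c j by
    obtain ⟨c, hc, h⟩ := H Finset.univ
    exact ⟨c, fun i j => h i (by simp) j (by simp), hc⟩
  intro S
  -- Words are chosen in order of non-decreasing length, so a new word only has to avoid extending
  -- earlier ones.
  induction S using Finset.induction_on_max_value l with
  | empty =>
    obtain ⟨a⟩ := ‹Nonempty A›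
    exact ⟨fun i => List.replicate (l i) a, by simp, by simp⟩
  | insert a S ha hmax ih =>
    obtain ⟨c, hc, hS⟩ := ih
    -- Strict because the term of `a` itself is absent from the sum.
    have hlt : ∑ i ∈ S, Fintype.card A ^ (l a - l i) < Fintype.card A ^ l a := by
      have h1 : ∑ i ∈ S, (1 / (Fintype.card A : ℝ)) ^ l i < 1 := by
        refine lt_of_lt_of_le ?_ hl
        exact Finset.sum_lt_sum_of_subset (Finset.subset_univ S) (Finset.mem_univ a) ha
          (by positivity) fun _ _ _ => by positivity
      have h2 : ((∑ i ∈ S, Fintype.card A ^ (l a - l i) : ℕ) : ℝ) =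
          (Fintype.card A : ℝ) ^ l a * ∑ i ∈ S, (1 / (Fintype.card A : ℝ)) ^ l i := by
        push_cast
        rw [Finset.mul_sum]
        refine Finset.sum_congr rfl fun i hi => ?_
        rw [one_div, inv_pow, pow_sub₀ _ hD.ne' (hmax i hi)]
      have h3 : ((∑ i ∈ S, Fintype.card A ^ (l a - l i) : ℕ) : ℝ) <
          ((Fintype.card A ^ l a : ℕ) : ℝ) := by
        rw [h2, Nat.cast_pow]
        exact mul_lt_of_lt_one_right (by positivity) h1
      exact_mod_cast h3
    obtain ⟨x, hx⟩ : ∃ x : List.Vector A (l a), ∀ i ∈ S, ¬ c i <+: x.1 := by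
      by_contra! hcon
      have hsub : (Finset.univ : Finset (List.Vector A (l a))) ⊆
          S.biUnion fun i => Finset.univ.filter fun x => c i <+: x.1 := by
        intro x _
        obtain ⟨i, hi, hp⟩ := hcon x
        exact Finset.mem_biUnion.2 ⟨i, hi, by simpa using hp⟩
      have := (Finset.card_le_card hsub).trans Finset.card_biUnion_le
      rw [Finset.card_univ, card_vector] at this
      refine absurd (this.trans (Finset.sum_le_sum fun i hi => ?_)) (not_le.2 hlt)
      have := card_filter_prefix_le (c i) (l a)
      rwa [hc i] at this
    refine ⟨Function.update c a x.1, fun i => ?_, ?_⟩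
    · rcases eq_or_ne i a with rfl | hi
      · simp
      · simpa [hi] using hc i
    · intro i hi j hj hij
      rcases Finset.mem_insert.1 hi with rfl | hiS
      · have hjS := (Finset.mem_insert.1 hj).resolve_left (Ne.symm hij)
        rw [Function.update_self, Function.update_of_ne (Ne.symm hij)]
        intro hp
        have hlen := hp.length_le
        have hxl : x.1.length = l i := x.2
        rw [hxl, hc j] at hlen
        -- The new word is at least as long as `c j`, so it can be a prefix only by equality.
        have hEq := hp.eq_of_length (by rw [hxl, hc j]; exact le_antisymm hlen (hmax j hjS))
        exact hx j hjS (hEq ▸ List.prefix_rfl)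
      · have hia : i ≠ a := fun h => ha (h ▸ hiS)
        rw [Function.update_of_ne hia]
        rcases Finset.mem_insert.1 hj with rfl | hjS
        · rw [Function.update_self]
          exact hx i hiS
        · have hja : j ≠ a := fun h => ha (h ▸ hjS)
          rw [Function.update_of_ne hja]
          exact hS i hiS j hjS hij

end Kraft

/-! ### Optimal codes as optimal assignments -/

section OptimalCodes

variable {A : Type*} {n : ℕ}

/-- The assignment of levels to the leaves that is given by a length function. -/
def leafAssignment (l : Fin n → ℕ) : Multiset (CodeTree n × ℕ) :=
  Multiset.map (fun i => (CodeTree.leaf i, l i)) Finset.univ.val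

lemma map_fst_leafAssignment (l : Fin n → ℕ) :
    (leafAssignment l).map Prod.fst = initialForest n := by
  rw [leafAssignment, initialForest, Multiset.map_map]
  rfl

lemma kraftSum_leafAssignment (D : ℕ) (l : Fin n → ℕ) :
    kraftSum D (leafAssignment l) = ∑ i, (1 / (D : ℝ)) ^ l i := by
  rw [kraftSum, leafAssignment, Multiset.map_map]
  rfl

lemma cost_leafAssignment (p : Fin n → ℝ) (l : Fin n → ℕ) :
    cost (CodeTree.prob p) (leafAssignment l) = ∑ i, p i * (l i : ℝ) := by
  rw [cost, leafAssignment, Multiset.map_map]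
  rfl

lemma forestLevels_leafAssignment (l : Fin n → ℕ) :
    forestLevels (leafAssignment l) = Multiset.map l Finset.univ.val := by
  rw [forestLevels, leafAssignment, Multiset.map_map]
  have : ((fun x : CodeTree n × ℕ => x.1.leafLevels.map (· + x.2)) ∘
      fun i => (CodeTree.leaf i, l i)) = fun i => {l i} := by
    funext i
    simp [CodeTree.leafLevels]
  rw [this, ← Multiset.sum_map_singleton (Multiset.map l _), Multiset.map_map]
  rfl

/-- The leaves are distinct, so every competing assignment is a length function. -/
lemma exists_eq_leafAssignment {u : Multiset (CodeTree n × ℕ)}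
    (hu : u.map Prod.fst = initialForest n) : ∃ l : Fin n → ℕ, u = leafAssignment l := by
  have hmem : ∀ i, ∃ k, (CodeTree.leaf i, k) ∈ u := by
    intro i
    have : CodeTree.leaf i ∈ u.map Prod.fst :=
      hu ▸ Multiset.mem_map_of_mem CodeTree.leaf (Finset.mem_univ i)
    obtain ⟨⟨t, k⟩, hx, rfl⟩ := Multiset.mem_map.1 this
    exact ⟨k, hx⟩
  choose l hl using hmem
  refine ⟨l, (Multiset.eq_of_le_of_card_le ?_ ?_).symm⟩
  · rw [Multiset.le_iff_subset]
    · intro x hx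
      obtain ⟨i, -, rfl⟩ := Multiset.mem_map.1 hx
      exact hl i
    · refine Multiset.Nodup.map (fun i j hij => ?_) Finset.univ.nodup
      simpa using congrArg Prod.fst hij
  · rw [← Multiset.card_map Prod.fst u, hu]
    simp [leafAssignment, initialForest]

/-- By the converse of Kraft's inequality, every competitor is realised by a prefix code of equal
cost. -/
lemma IsOptimalCode.isOptimalAssignment [Fintype A] [Nonempty A] {p : Fin n → ℝ}
    {c : Fin n → List A} (hc : IsOptimalCode p c) (hn : 2 ≤ n) :
    IsOptimalAssignment (Fintype.card A) (CodeTree.prob p)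
      (leafAssignment fun i => (c i).length) := by
  refine ⟨by simpa [kraftSum_leafAssignment] using hc.1.kraft hn, fun u hu hk => ?_⟩
  rw [map_fst_leafAssignment] at hu
  obtain ⟨l, rfl⟩ := exists_eq_leafAssignment hu
  rw [kraftSum_leafAssignment] at hk
  obtain ⟨c', hc', hl⟩ := exists_isPrefixCode (A := A) l hk
  simpa [cost_leafAssignment, expectedLength, hl] using hc.2 c' hc'

/-- A code for a single symbol is optimal only if its codeword is empty. -/
lemma IsOptimalCode.eq_nil {p : Fin 1 → ℝ} (hp : 0 < p 0) {c : Fin 1 → List A}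
    (hc : IsOptimalCode p c) : c 0 = [] := by
  have h := hc.2 (fun _ => []) fun i j hij => absurd (Subsingleton.elim i j) hij
  simp only [expectedLength, Finset.univ_unique, Finset.sum_singleton, List.length_nil,
    Nat.cast_zero, mul_zero] at h
  by_contra hne
  have : 0 < p 0 * ((c 0).length : ℝ) :=
    mul_pos hp (by exact_mod_cast List.length_pos_iff.2 hne)
  exact absurd h (not_le.2 this)

/-- A prefix code with at least two codewords needs at least two letters. -/
lemma IsPrefixCode.two_le_card [Fintype A] {c : Fin n → List A} (hc : IsPrefixCode c)
    (hn : 2 ≤ n) : 2 ≤ Fintype.card A := by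
  by_contra! hlt
  have hsub : Subsingleton A := Fintype.card_le_one_iff_subsingleton.1 (by omega)
  let i : Fin n := ⟨0, by omega⟩
  let j : Fin n := ⟨1, by omega⟩
  have hij : i ≠ j := by simp [i, j]
  obtain ⟨a, -⟩ := List.exists_mem_of_ne_nil _ (hc.ne_nil hn i)
  have hrep : ∀ v : List A, v = List.replicate v.length a := fun v =>
    List.eq_replicate_of_mem fun b _ => Subsingleton.elim b a
  have key : ∀ v w : List A, v.length ≤ w.length → v <+: w := by
    intro v w h
    rw [hrep v, hrep w]
    refine ⟨List.replicate (w.length - v.length) a, ?_⟩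
    rw [List.replicate_append_replicate, Nat.add_sub_cancel' h]
  rcases le_total (c i).length (c j).length with h | h
  · exact hc i j hij (key _ _ h)
  · exact hc j i hij.symm (key _ _ h)

lemma exists_first_merge_arity {D n : ℕ} (hD : 2 ≤ D) (hn : 2 ≤ n) :
    ∃ m : ℕ, 2 ≤ m ∧ m ≤ D ∧ m ≤ n ∧ (D : ℤ) - 1 ∣ (n : ℤ) - m := by
  -- The representative of `n` modulo `D - 1` in `[2, D]`.
  refine ⟨(n - 2) % (D - 1) + 2, by omega, ?_, ?_, ?_⟩
  · have := Nat.mod_lt (n - 2) (by omega : 0 < D - 1)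
    omega
  · have := Nat.mod_le (n - 2) (D - 1)
    omega
  · refine ⟨((n - 2) / (D - 1) : ℕ), ?_⟩
    have := Nat.div_add_mod (n - 2) (D - 1)
    have hcast : ((D - 1 : ℕ) : ℤ) = D - 1 := by omega
    rw [← hcast, ← Nat.cast_mul]
    omega

end OptimalCodes

end HuffmanCoding

open HuffmanCoding in
theorem mainTheorem5 {A : Type*} [Fintype A] {n : ℕ} (p : Fin n → ℝ)
    (hp : p ∈ HuffmanCoding.posPMF n) (L : List ℕ)
    (hL : HuffmanCoding.IsOptimalLengthSeq A p L) :
    ∃ T : HuffmanCoding.CodeTree n,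
      HuffmanCoding.IsHuffmanTree (Fintype.card A) p T ∧ T.lengthSeq = L := by
  obtain ⟨c, hc, rfl⟩ := hL
  obtain ⟨hpos, hsum⟩ := hp
  rcases Nat.lt_or_ge n 2 with hn | hn
  · have hn1 : n = 1 := by
      rcases Nat.eq_zero_or_pos n with rfl | h
      · simp at hsum
      · omega
    subst hn1
    refine ⟨CodeTree.leaf 0, Or.inl rfl, ?_⟩
    simp [CodeTree.lengthSeq, codeLengthSeq, CodeTree.leafLevels, hc.eq_nil (hpos 0)]
  · have hD := hc.1.two_le_card hn
    have : Nonempty A := Fintype.card_pos_iff.1 (by omega)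
    obtain ⟨m, hm, hmD, hmn, hdvd⟩ := exists_first_merge_arity hD hn
    have hcard : (leafAssignment fun i => (c i).length).card = n := by simp [leafAssignment]
    obtain ⟨s, hstep, hopt, hw, hs, hlev⟩ := exists_merge (hc.isOptimalAssignment hn) hD
      (fun x hx => by
        obtain ⟨i, -, rfl⟩ := Multiset.mem_map.1 hx
        exact hpos i) (hcard.symm ▸ hn) hm hmD (hcard.symm ▸ hdvd)
    rw [map_fst_leafAssignment] at hstep
    rw [hcard] at hs
    -- After the first merge `s.card - 1 = n - m`, which gives the congruence needed for merging `D`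
    -- at a time.
    obtain ⟨T, hT, hl⟩ := exists_reflTransGen_merge hD s.card rfl hopt hw (by omega) (by
      convert hdvd using 1
      omega)
    refine ⟨T, Or.inr ⟨m, _, hm, hmD, hdvd, hstep, hT⟩, ?_⟩
    rw [CodeTree.lengthSeq, codeLengthSeq, hl, hlev, forestLevels_leafAssignment]
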